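/- Let $G=(V,E)$ be a finite undirected graph, where loops and parallel edges are allowed. Suppose that $G$ is bridgeless (deleting an edge never disconnects its two ends) and triangulated, i.e. chordal: every circuit of length at least $4$ has a chord, that is, there is an edge of $G$ joining two vertices of the circuit that are not consecutive on it. Then: (1) $G$ has a nowhere-zero $4$-flow; that is, there are an orientation of $G$ and a map $\phi:E\to\mathbb{Z}_4\setminus\{0\}$ such that for every vertex $v$ the sum of $\phi(e)$ over the arcs $e$ with head $v$ minus the sum of $\phi(e)$ over the arcs $e$ with tail $v$ is $0$ in $\mathbb{Z}_4$. (2) There is an orientation $D$ of $G$ for which the zero map is the only $0$-conformal dual $4$-flow; that is, for a map $\phi:E\to\mathbb{Z}_4$, the following two conditions hold together if and only if $\phi=0$: $\phi(e)\in\{0,3\}$ for every $e\in E$, and around every circuit of $G$ the signed sum of $\phi$ is $0$ in $\mathbb{Z}_4$. Here an arc of $D$ is counted with sign $+$ if it is traversed from tail to head and with sign $-$ otherwise, and loops and pairs of parallel edges are circuits of length $1$ and $2$. -/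

import Mathlib

namespace Graph

variable {α β : Type*}

/-- An orientation of a multigraph: a choice of tail and head for every edge. -/
structure Orientation (G : Graph α β) where
  tail : G.edgeSet → α
  head : G.edgeSet → α
  isLink : ∀ e : G.edgeSet, G.IsLink e (tail e) (head e)

/-- A circuit of length `n ≥ 1` of a multigraph, listed in cyclic order: `n` distinct vertices and
`n` distinct edges, the `i`-th edge joining the `i`-th vertex to the next one.
A loop is a circuit of length 1 and two parallel edges form a circuit of length 2. -/
structure Circuit (G : Graph α β) (n : ℕ) [NeZero n] where
  vert : ZMod n → α
  edge : ZMod n → G.edgeSet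
  vert_injective : Function.Injective vert
  edge_injective : Function.Injective edge
  isLink : ∀ i, G.IsLink (edge i) (vert i) (vert (i + 1))

/-- An edge is a bridge if deleting it disconnects its two ends. -/
def IsBridge (G : Graph α β) (e : β) : Prop :=
  e ∈ G.edgeSet ∧
    ∀ x y, G.IsLink e x y → ¬ Relation.ReflTransGen (G.deleteEdges {e}).Adj x y

def Bridgeless (G : Graph α β) : Prop := ∀ e, ¬ G.IsBridge e

/-- Every circuit of length at least 4 has a chord, that is, an edge joining two vertices of the
circuit that are not consecutive on it. -/
def IsChordal (G : Graph α β) : Prop :=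
  ∀ (n : ℕ) [NeZero n], 4 ≤ n → ∀ C : G.Circuit n,
    ∃ i j : ZMod n, i ≠ j ∧ j ≠ i + 1 ∧ i ≠ j + 1 ∧ G.Adj (C.vert i) (C.vert j)

/-- `φ` is a `p`-flow: at each vertex, inflow minus outflow vanishes in `ℤ/p`.
(The sums are over the arcs with head `v`, respectively tail `v`; the edge set will be finite.) -/
def Orientation.IsFlow {G : Graph α β} (D : G.Orientation) {p : ℕ}
    (φ : G.edgeSet → ZMod p) : Prop :=
  ∀ v ∈ G.vertexSet,
    (∑ᶠ e ∈ {e | D.head e = v}, φ e) - (∑ᶠ e ∈ {e | D.tail e = v}, φ e) = 0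

open Classical in
/-- The signed sum of `φ` around the circuit `C`: an arc counts positively if it is traversed from
tail to head and negatively otherwise. (A loop, being a circuit by itself, counts positively.) -/
noncomputable def Orientation.circuitSum {G : Graph α β} (D : G.Orientation) {p : ℕ}
    (φ : G.edgeSet → ZMod p) {n : ℕ} [NeZero n] (C : G.Circuit n) : ZMod p :=
  ∑ i : ZMod n, if D.tail (C.edge i) = C.vert i then φ (C.edge i) else -φ (C.edge i)

/-- `φ` is a dual `p`-flow: its signed sum around each circuit vanishes in `ℤ/p`. -/
def Orientation.IsDualFlow {G : Graph α β} (D : G.Orientation) {p : ℕ}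
    (φ : G.edgeSet → ZMod p) : Prop :=
  ∀ (n : ℕ) [NeZero n] (C : G.Circuit n), D.circuitSum φ C = 0

/-- `G` is `p`-flowing: some orientation of `G` admits a nowhere-zero `p`-flow. -/
def IsFlowing (G : Graph α β) (p : ℕ) : Prop :=
  ∃ (D : G.Orientation) (φ : G.edgeSet → ZMod p), D.IsFlow φ ∧ ∀ e, φ e ≠ 0

/-- `φ` is `ψ`-conformal: `φ(e) ∈ {ψ(e), p - 1}` for every edge `e`, where the label `p - 1` is
the residue class `-1`. -/
def IsConformal {G : Graph α β} {p : ℕ} (ψ φ : G.edgeSet → ZMod p) : Prop :=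
  ∀ e, φ e = ψ e ∨ φ e = -1

end Graph

/-!
A geodesic joining the ends of a non-bridge `e` in `G - e` closes up with `e` to a chordless
circuit, since a chord would be a shortcut. Hence in a bridgeless graph all of whose circuits of
length at least `p` have chords, every edge lies on a circuit of length less than `p`.

For the flow, process the circuits of such a cover one by one. Adding `a ∈ ℤ/p` along a circuit of
length `n < p` makes all its edges nonzero for at least `p - n` values of `a`, and does not touch
the edges off the circuit.

For the orientation, well-order the circuits of the cover and direct each edge along the first
circuit through it. A `0`-conformal dual flow then vanishes on one circuit after another: its signed
sum around the circuit is a vanishing sum of fewer than `p` terms `0` or `-1`, because every edge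
traversed backwards belongs to an earlier circuit.
-/

namespace Multigraph

open Graph

section Geodesic

variable {V : Type*}

theorem reachable_fromRel_of_reflTransGen {r : V → V → Prop} {x y : V}
    (h : Relation.ReflTransGen r x y) : (SimpleGraph.fromRel r).Reachable x y := by
  induction h with
  | refl => exact .rfl
  | @tail b c _ hbc ih =>
    obtain rfl | hne := eq_or_ne b c
    · exact ih
    · exact ih.trans (SimpleGraph.Adj.reachable ⟨hne, .inl hbc⟩)

theorem dist_getVert_getVert_of_length_eq_dist {H : SimpleGraph V} {x y : V} {w : H.Walk x y}
    (hw : w.length = H.dist x y) {i j : ℕ} (hij : i ≤ j) (hj : j ≤ w.length) :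
    H.dist (w.getVert i) (w.getVert j) = j - i := by
  have hsub : ((w.drop i).take (j - i)).IsSubwalk w :=
    (SimpleGraph.Walk.isSubwalk_take _ _).trans (SimpleGraph.Walk.isSubwalk_drop _ _)
  have hdist := SimpleGraph.length_eq_dist_of_subwalk hw hsub
  rw [SimpleGraph.Walk.take_length, SimpleGraph.Walk.drop_length,
    SimpleGraph.Walk.drop_getVert, Nat.add_sub_cancel' hij] at hdist
  omega

end Geodesic

variable {α β : Type*} {G : Graph α β}

section ChordlessCircuit

/-- `C` has a chord: an edge of the graph joins two vertices of `C` that are not consecutive on it.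
For circuits of length at least 4 this is the notion occurring in `Graph.IsChordal`. -/
def HasChord {n : ℕ} [NeZero n] (C : G.Circuit n) : Prop :=
  ∃ i j : ZMod n, i ≠ j ∧ j ≠ i + 1 ∧ i ≠ j + 1 ∧ G.Adj (C.vert i) (C.vert j)

variable {m : ℕ} {v : Fin (m + 1) → α} {f : Fin m → G.edgeSet} {e : G.edgeSet}

theorem injective_of_isLink_castSucc_succ (hv : Function.Injective v)
    (hf : ∀ i, G.IsLink (f i) (v i.castSucc) (v i.succ)) : Function.Injective f := by
  intro i j hij
  have hlink := hf i
  rw [hij] at hlink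
  rcases hlink.eq_and_eq_or_eq_and_eq (hf j) with ⟨hi, -⟩ | ⟨hi, hj⟩
  · exact Fin.castSucc_injective m (hv hi)
  · have hi' := congrArg Fin.val (hv hi)
    have hj' := congrArg Fin.val (hv hj)
    simp only [Fin.val_castSucc, Fin.val_succ] at hi' hj'
    omega

/-- The circuit obtained from the path with vertices `v` and edges `f` by adding the edge `e` that
joins its last vertex to its first one. The indices in `ZMod (m + 1)` are those in `Fin (m + 1)`,
so `e` is the edge with index `m`. -/
def circuitOfPath (hv : Function.Injective v)
    (hf : ∀ i, G.IsLink (f i) (v i.castSucc) (v i.succ)) (hfe : e ∉ Set.range f)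
    (he : G.IsLink e (v (Fin.last m)) (v 0)) : G.Circuit (m + 1) where
  vert := v
  edge := Fin.snoc (α := fun _ => G.edgeSet) f e
  vert_injective := hv
  edge_injective :=
    Fin.snoc_injective_of_injective (injective_of_isLink_castSucc_succ hv hf) hfe
  isLink := by
    change ∀ i : Fin (m + 1),
      G.IsLink (Fin.snoc (α := fun _ => G.edgeSet) f e i) (v i) (v (i + 1))
    refine Fin.lastCases ?_ fun i => ?_
    · simpa only [Fin.snoc_last, Fin.last_add_one] using he
    · simpa only [Fin.snoc_castSucc, Fin.coeSucc_eq_succ] using hf i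

theorem not_hasChord_circuitOfPath (hv : Function.Injective v)
    (hf : ∀ i, G.IsLink (f i) (v i.castSucc) (v i.succ)) (hfe : e ∉ Set.range f)
    (he : G.IsLink e (v (Fin.last m)) (v 0))
    (hgeo : ∀ i j, i < j → (G.deleteEdges {e.1}).Adj (v i) (v j) → j = i + 1) :
    ¬ HasChord (circuitOfPath hv hf hfe he) := by
  rintro ⟨(i : Fin (m + 1)), (j : Fin (m + 1)), hij, (hj : j ≠ i + 1), (hi : i ≠ j + 1),
    (hadj : G.Adj (v i) (v j))⟩
  wlog hlt : i < j generalizing i j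
  · exact this j i hij.symm hi hj hadj.symm (lt_of_le_of_ne (not_lt.1 hlt) hij.symm)
  obtain ⟨g, hg⟩ := hadj
  refine hj (hgeo i j hlt ⟨g, ?_⟩)
  rw [deleteEdges_isLink]
  refine ⟨hg, fun hge => ?_⟩
  rw [Set.mem_singleton_iff.1 hge] at hg
  rcases hg.eq_and_eq_or_eq_and_eq he with ⟨hilast, -⟩ | ⟨hi0, hjlast⟩
  · exact (hlt.trans_le (Fin.le_last j)).ne (hv hilast)
  · exact hi (by rw [hv hi0, hv hjlast, Fin.last_add_one])

theorem exists_circuit_not_hasChord (he : ¬ G.IsBridge e) :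
    ∃ (n : ℕ) (_ : NeZero n) (C : G.Circuit n), ¬ HasChord C ∧ e ∈ Set.range C.edge := by
  obtain ⟨x, y, hxy, hreach⟩ : ∃ x y, G.IsLink e x y ∧
      Relation.ReflTransGen (G.deleteEdges {e.1}).Adj x y := by
    simpa [IsBridge] using he
  obtain ⟨w, hw⟩ := (reachable_fromRel_of_reflTransGen hreach).exists_walk_length_eq_dist
  have hv : Function.Injective fun i : Fin (w.length + 1) => w.getVert i := fun i j hij =>
    Fin.ext <| (w.isPath_of_length_eq_dist hw).getVert_injOn
      (Nat.le_of_lt_succ i.2) (Nat.le_of_lt_succ j.2) hij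
  have hstep (i : Fin w.length) :
      ∃ f : G.edgeSet, G.IsLink f (w.getVert i) (w.getVert (i + 1)) ∧ e ≠ f := by
    obtain ⟨f, hf⟩ := (w.adj_getVert_succ i.2).2.elim id Adj.symm
    rw [deleteEdges_isLink] at hf
    exact ⟨⟨f, hf.1.edge_mem⟩, hf.1, fun hef => hf.2 (congrArg Subtype.val hef).symm⟩
  choose f hf hfe using hstep
  have hclose :
      G.IsLink e (w.getVert (Fin.last w.length)) (w.getVert (0 : Fin (w.length + 1))) := by
    simpa using hxy.symm
  refine ⟨w.length + 1, inferInstance,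
    circuitOfPath hv hf (fun ⟨i, hi⟩ => hfe i hi.symm) hclose, ?_,
    Fin.last w.length, Fin.snoc_last (α := fun _ => G.edgeSet) _ _⟩
  refine not_hasChord_circuitOfPath _ _ _ _ fun i j hij hadj => ?_
  have hdist := SimpleGraph.dist_eq_one_iff_adj.2
    (show (SimpleGraph.fromRel _).Adj _ _ from ⟨fun h => hij.ne (hv h), .inl hadj⟩)
  rw [dist_getVert_getVert_of_length_eq_dist hw hij.le (Nat.le_of_lt_succ j.2)] at hdist
  refine Fin.ext ?_
  rw [Fin.val_add_one_of_lt (hij.trans_le (Fin.le_last j))]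
  omega

theorem exists_circuit_lt_of_bridgeless {p : ℕ} (hbridge : G.Bridgeless)
    (hchord : ∀ (n : ℕ) [NeZero n], p ≤ n → ∀ C : G.Circuit n, HasChord C) (e : G.edgeSet) :
    ∃ (n : ℕ) (_ : NeZero n) (C : G.Circuit n), n < p ∧ e ∈ Set.range C.edge := by
  obtain ⟨n, _, C, hC, he⟩ := exists_circuit_not_hasChord (hbridge e)
  exact ⟨n, _, C, lt_of_not_ge fun hn => hC (hchord n hn C), he⟩

end ChordlessCircuit

section Flow

variable {p : ℕ}

/-- Inflow minus outflow at `v`, as an additive map, so that `D.IsFlow φ` says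
`netInflow D p v φ = 0` for all vertices `v`. Finitely many edges are needed for additivity. -/
noncomputable def netInflow [Finite G.edgeSet] (D : G.Orientation) (p : ℕ) (v : α) :
    (G.edgeSet → ZMod p) →+ ZMod p :=
  .mk' (fun φ => (∑ᶠ e ∈ {e | D.head e = v}, φ e) - ∑ᶠ e ∈ {e | D.tail e = v}, φ e) fun φ ψ => by
    simp only [Pi.add_apply, finsum_mem_add_distrib (Set.toFinite _)]
    abel

open Classical in
theorem netInflow_single [Finite G.edgeSet] (D : G.Orientation) (v : α) (e : G.edgeSet)
    (a : ZMod p) :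
    netInflow D p v (Pi.single e a) =
      (if D.head e = v then a else 0) - if D.tail e = v then a else 0 := by
  have hsum (s : Set G.edgeSet) :
      ∑ᶠ f ∈ s, (Pi.single e a : G.edgeSet → ZMod p) f = if e ∈ s then a else 0 := by
    rw [finsum_mem_def, finsum_eq_single _ e]
    · simp [Set.indicator_apply]
    · intro f hf
      simp [hf]
  exact congrArg₂ (· - ·) (hsum {f | D.head f = v}) (hsum {f | D.tail f = v})

open Classical in
/-- The sign with which `e` is traversed when it is left through its end `x`: positive if `x` is
its tail. A loop is always traversed positively, as in `Graph.Orientation.circuitSum`. -/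
noncomputable def traversalSign (D : G.Orientation) (e : G.edgeSet) (x : α) : ℤˣ :=
  if D.tail e = x then 1 else -1

open Classical in
theorem netInflow_single_traversalSign [Finite G.edgeSet] (D : G.Orientation) (v : α)
    {e : G.edgeSet} {x y : α} (he : G.IsLink e x y) (a : ZMod p) :
    netInflow D p v (Pi.single e (traversalSign D e x • a)) =
      (if y = v then a else 0) - if x = v then a else 0 := by
  rw [netInflow_single]
  by_cases htail : D.tail e = x
  · subst htail
    rw [he.right_unique (D.isLink e), traversalSign, if_pos rfl, one_smul]
  · obtain ⟨hy, hx⟩ := ((D.isLink e).eq_and_eq_or_eq_and_eq he).resolve_left fun h => htail h.1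
    rw [traversalSign, if_neg htail, hy, hx]
    split_ifs <;> simp

variable {n : ℕ} [NeZero n]

open Classical in
/-- The flow that sends `a` around the circuit `C` in the direction of `C`. -/
noncomputable def circuitFlow (D : G.Orientation) (C : G.Circuit n) (a : ZMod p) :
    G.edgeSet → ZMod p :=
  ∑ i, Pi.single (C.edge i) (traversalSign D (C.edge i) (C.vert i) • a)

theorem circuitFlow_edge (D : G.Orientation) (C : G.Circuit n) (a : ZMod p) (i : ZMod n) :
    circuitFlow D C a (C.edge i) = traversalSign D (C.edge i) (C.vert i) • a := by
  classical
  simp only [circuitFlow, Finset.sum_apply, Pi.single_apply, C.edge_injective.eq_iff,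
    Finset.sum_ite_eq, Finset.mem_univ, if_true]

theorem circuitFlow_of_notMem (D : G.Orientation) (C : G.Circuit n) (a : ZMod p) {e : G.edgeSet}
    (he : e ∉ Set.range C.edge) : circuitFlow D C a e = 0 := by
  classical
  rw [circuitFlow, Finset.sum_apply]
  exact Finset.sum_eq_zero fun i _ => Pi.single_eq_of_ne (fun h => he ⟨i, h.symm⟩) _

theorem isFlow_circuitFlow [Finite G.edgeSet] (D : G.Orientation) (C : G.Circuit n)
    (a : ZMod p) : D.IsFlow (circuitFlow D C a) := by
  classical
  intro v _
  have hshift : ∑ i, (if C.vert (i + 1) = v then a else 0) = ∑ i, if C.vert i = v then a else 0 :=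
    Fintype.sum_equiv (Equiv.addRight 1) _ _ fun _ => rfl
  change netInflow D p v (circuitFlow D C a) = 0
  simp only [circuitFlow, map_sum, netInflow_single_traversalSign D v (C.isLink _),
    Finset.sum_sub_distrib, hshift, sub_self]

theorem isFlow_add [Finite G.edgeSet] {D : G.Orientation} {φ ψ : G.edgeSet → ZMod p}
    (hφ : D.IsFlow φ) (hψ : D.IsFlow ψ) : D.IsFlow (φ + ψ) := fun v hv =>
  (map_add (netInflow D p v) φ ψ).trans
    ((congrArg₂ (· + ·) (hφ v hv) (hψ v hv)).trans (add_zero 0))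

theorem exists_circuitFlow_add_ne_zero (D : G.Orientation) (hn : n < p) (C : G.Circuit n)
    (φ : G.edgeSet → ZMod p) : ∃ a : ZMod p, ∀ i, (φ + circuitFlow D C a) (C.edge i) ≠ 0 := by
  classical
  have : NeZero p := ⟨by omega⟩
  let forbidden : Finset (ZMod p) := Finset.univ.image fun i : ZMod n =>
    (traversalSign D (C.edge i) (C.vert i))⁻¹ • -φ (C.edge i)
  have hcard : forbidden.card < Fintype.card (ZMod p) :=
    Finset.card_image_le.trans_lt (by simpa [ZMod.card] using hn)
  obtain ⟨a, ha⟩ := Finset.exists_mem_notMem_of_card_lt_card hcard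
  refine ⟨a, fun i hi => ha.2 (Finset.mem_image.2 ⟨i, Finset.mem_univ i, ?_⟩)⟩
  rw [Pi.add_apply, circuitFlow_edge] at hi
  exact inv_smul_eq_iff.2 (neg_eq_of_add_eq_zero_right hi)

theorem exists_isFlow_union_range_subset_support [Finite G.edgeSet] {D : G.Orientation} (hn : n < p)
    (C : G.Circuit n) {φ : G.edgeSet → ZMod p} (hφ : D.IsFlow φ) :
    ∃ ψ : G.edgeSet → ZMod p, D.IsFlow ψ ∧
      Function.support φ ∪ Set.range C.edge ⊆ Function.support ψ := by
  obtain ⟨a, ha⟩ := exists_circuitFlow_add_ne_zero D hn C φ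
  refine ⟨_, isFlow_add hφ (isFlow_circuitFlow D C a), fun e he => ?_⟩
  by_cases heC : e ∈ Set.range C.edge
  · obtain ⟨i, rfl⟩ := heC
    exact ha i
  · rw [Function.mem_support, Pi.add_apply, circuitFlow_of_notMem D C a heC, add_zero]
    exact he.resolve_right heC

theorem exists_isFlow_ne_zero [Finite G.edgeSet] (D : G.Orientation)
    (hcover : ∀ e : G.edgeSet,
      ∃ (n : ℕ) (_ : NeZero n) (C : G.Circuit n), n < p ∧ e ∈ Set.range C.edge) :
    ∃ φ : G.edgeSet → ZMod p, D.IsFlow φ ∧ ∀ e, φ e ≠ 0 := by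
  suffices h : ∃ φ : G.edgeSet → ZMod p, D.IsFlow φ ∧ Set.univ ⊆ Function.support φ by
    simpa [Set.univ_subset_iff, Set.eq_univ_iff_forall] using h
  induction (Set.univ : Set G.edgeSet), Set.toFinite (Set.univ : Set G.edgeSet)
    using Set.Finite.induction_on with
  | empty => exact ⟨0, fun v _ => by simp, Set.empty_subset _⟩
  | @insert e S _ _ ih =>
    obtain ⟨φ, hφ, hS⟩ := ih
    obtain ⟨n, _, C, hn, he⟩ := hcover e
    obtain ⟨ψ, hψ, hsupp⟩ := exists_isFlow_union_range_subset_support hn C hφ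
    exact ⟨ψ, hψ, Set.insert_subset (hsupp (.inr he))
      (hS.trans (Set.subset_union_left.trans hsupp))⟩

end Flow

section DualFlow

theorem nonempty_orientation (G : Graph α β) : Nonempty G.Orientation := by
  choose tail head hlink using fun e : G.edgeSet => exists_isLink_of_mem_edgeSet e.2
  exact ⟨⟨tail, head, hlink⟩⟩

theorem eq_zero_of_sum_eq_zero_of_eq_zero_or_neg_one {ι R : Type*} [Fintype ι]
    [NonAssocRing R] {p : ℕ} [CharP R p] (hcard : Fintype.card ι < p) {f : ι → R}
    (hf : ∀ i, f i = 0 ∨ f i = -1) (hsum : ∑ i, f i = 0) (i : ι) : f i = 0 := by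
  classical
  have hf' (j : ι) : f j = -(if f j ≠ 0 then 1 else 0) := by
    rcases eq_or_ne (f j) 0 with hj | hj
    · simp [hj]
    · rw [if_pos hj, (hf j).resolve_left hj]
  rw [Finset.sum_congr rfl fun j _ => hf' j, Finset.sum_neg_distrib, neg_eq_zero,
    Finset.sum_boole, CharP.cast_eq_zero_iff R p] at hsum
  have hempty := Nat.eq_zero_of_dvd_of_lt hsum ((Finset.card_filter_le _ _).trans_lt hcard)
  simpa using Finset.filter_eq_empty_iff.1 (Finset.card_eq_zero.1 hempty) (Finset.mem_univ i)

variable {ι : Type*} {n : ι → ℕ} [∀ k, NeZero (n k)]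

theorem exists_orientation_tail_eq_vert (C : ∀ k, G.Circuit (n k)) {c : G.edgeSet → ι}
    (hc : ∀ e, e ∈ Set.range (C (c e)).edge) :
    ∃ D : G.Orientation, ∀ k i, c ((C k).edge i) = k → D.tail ((C k).edge i) = (C k).vert i := by
  choose i hi using hc
  refine ⟨⟨fun e => (C (c e)).vert (i e), fun e => (C (c e)).vert (i e + 1), fun e => ?_⟩,
    fun k j hk => ?_⟩
  · simpa only [hi] using (C (c e)).isLink (i e)
  · generalize he : (C k).edge j = e at hk ⊢
    subst hk
    exact congrArg _ ((C _).edge_injective ((hi e).trans he.symm))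

theorem exists_orientation_isConformal_zero_eq_zero {p : ℕ} (C : ∀ k, G.Circuit (n k))
    (hn : ∀ k, n k < p) (hcover : ∀ e, ∃ k, e ∈ Set.range (C k).edge) :
    ∃ D : G.Orientation, ∀ φ : G.edgeSet → ZMod p,
      D.IsDualFlow φ → IsConformal 0 φ → φ = 0 := by
  obtain ⟨_, _⟩ := exists_wellFoundedLT ι
  choose first hfirst hmin using fun e =>
    wellFounded_lt.has_min {k | e ∈ Set.range (C k).edge} (hcover e)
  obtain ⟨D, hD⟩ := exists_orientation_tail_eq_vert C hfirst
  refine ⟨D, fun φ hφ hconf => ?_⟩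
  suffices hzero : ∀ k i, φ ((C k).edge i) = 0 by
    funext e
    obtain ⟨k, i, rfl⟩ := hcover e
    exact hzero k i
  intro k
  induction k using WellFoundedLT.induction with
  | ind k ih =>
    have hterm (i : ZMod (n k)) :
        φ ((C k).edge i) = 0 ∨ D.tail ((C k).edge i) = (C k).vert i := by
      rcases (not_lt.1 (hmin _ k ⟨i, rfl⟩)).lt_or_eq with hlt | heq
      · obtain ⟨j, hj⟩ := hfirst ((C k).edge i)
        exact .inl (hj ▸ ih _ hlt j)
      · exact .inr (hD k i heq)
    have hsum : ∑ i, φ ((C k).edge i) = 0 := by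
      rw [← hφ (n k) (C k), Orientation.circuitSum]
      refine Finset.sum_congr rfl fun i _ => ?_
      rcases hterm i with hi | hi <;> simp [hi]
    exact eq_zero_of_sum_eq_zero_of_eq_zero_or_neg_one (by rw [ZMod.card]; exact hn k)
      (fun i => hconf ((C k).edge i)) hsum

theorem isDualFlow_zero (D : G.Orientation) (p : ℕ) :
    D.IsDualFlow (0 : G.edgeSet → ZMod p) := fun n _ C => by
  simp [Orientation.circuitSum]

end DualFlow

end Multigraph

open Multigraph in
theorem mainTheorem5_general {α β : Type*} {G : Graph α β} {p : ℕ} (hbridge : G.Bridgeless)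
    (hchord : ∀ (n : ℕ) [NeZero n], p ≤ n → ∀ C : G.Circuit n, HasChord C) :
    (G.edgeSet.Finite → G.IsFlowing p) ∧
      ∃ D : G.Orientation, ∀ φ : G.edgeSet → ZMod p,
        (D.IsDualFlow φ ∧ Graph.IsConformal 0 φ) ↔ φ = 0 := by
  have hcover := exists_circuit_lt_of_bridgeless hbridge hchord
  constructor
  · intro hE
    have : Finite G.edgeSet := hE
    obtain ⟨D⟩ := nonempty_orientation G
    exact ⟨D, exists_isFlow_ne_zero D hcover⟩
  · choose n hn0 C hn he using hcover
    obtain ⟨D, hD⟩ := exists_orientation_isConformal_zero_eq_zero C hn fun e => ⟨e, he e⟩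
    refine ⟨D, fun φ => ⟨fun h => hD φ h.1 h.2, ?_⟩⟩
    rintro rfl
    exact ⟨isDualFlow_zero D p, fun _ => .inl rfl⟩

theorem mainTheorem5 {α β : Type*} (G : Graph α β)
    (hV : G.vertexSet.Finite) (hE : G.edgeSet.Finite)
    (hbridge : G.Bridgeless) (hchordal : G.IsChordal) :
    G.IsFlowing 4 ∧
      ∃ D : G.Orientation, ∀ φ : G.edgeSet → ZMod 4,
        (D.IsDualFlow φ ∧ Graph.IsConformal 0 φ) ↔ φ = 0 := by
  obtain ⟨hflow, hdual⟩ := mainTheorem5_general hbridge hchordal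
  exact ⟨hflow hE, hdual⟩
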